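/- For $n,k\in\mathbb{N}$ let $\{0,\dots,n-1\}^k$ carry the coordinatewise order. In the problem $\mathrm{TARSKI}(n,k)$ one is given oracle access to an unknown monotone function $f:\{0,\dots,n-1\}^k\to\{0,\dots,n-1\}^k$ (a query at a vertex $v$ returns $f(v)$), and has to output a vertex $x$ with $f(x)=x$. A randomized algorithm is a probability distribution over deterministic (adaptive) query algorithms. The randomized query complexity of $\mathrm{TARSKI}(n,k)$ is the infimum, over all randomized algorithms that for every monotone $f$ output a fixed point of $f$ with probability at least $9/10$, of the maximum over monotone $f$ of the expected number of queries made on $f$, where the expectation is over the coin tosses of the algorithm. Theorem. There is an absolute constant $c>0$ such that for all integers $k\ge 2$ and $n\ge 2$, the randomized query complexity of $\mathrm{TARSKI}(n,k)$ is at least $$c\cdot\Bigl(k+\frac{k\log n}{\log k}\Bigr).$$ -/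

import Mathlib

open scoped ENNReal

/-- The `k`-dimensional grid `{0, …, n-1}^k`, with the coordinatewise order. -/
abbrev Grid (n k : ℕ) : Type := Fin k → Fin n

/-- Deterministic query algorithms (decision trees) with access to an oracle `V → V`:
either stop and output a vertex, or query a vertex and continue depending on the answer.
The output vertex need not have been queried. -/
inductive QueryTree (V : Type) : Type
  | output (x : V) : QueryTree V
  | query (v : V) (next : V → QueryTree V) : QueryTree V

namespace QueryTree

/-- The vertex that the algorithm outputs when the oracle is `f`. -/
def result {V : Type} (f : V → V) : QueryTree V → V
  | output x => x
  | query v next => result f (next (f v))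

/-- The number of queries that the algorithm makes when the oracle is `f`. -/
def numQueries {V : Type} (f : V → V) : QueryTree V → ℕ
  | output _ => 0
  | query v next => numQueries f (next (f v)) + 1

end QueryTree

/-- A randomized query algorithm is a probability distribution over deterministic ones. (For a
finite `V` there are only countably many trees, so every distribution over them is a `PMF`.) -/
abbrev RandomizedQueryAlgorithm (V : Type) : Type := PMF (QueryTree V)

namespace RandomizedQueryAlgorithm

/-- The probability that the algorithm outputs a fixed point of `f`. -/
noncomputable def successProb {V : Type} (A : RandomizedQueryAlgorithm V) (f : V → V) : ℝ≥0∞ :=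
  A.toOuterMeasure {t | f (t.result f) = t.result f}

/-- The expected number of queries on the oracle `f`, over the coin tosses of the algorithm. -/
noncomputable def expectedQueries {V : Type} (A : RandomizedQueryAlgorithm V) (f : V → V) :
    ℝ≥0∞ :=
  ∑' t, A t * (t.numQueries f : ℝ≥0∞)

/-- The algorithm solves the Tarski search problem on the ordered set `V`: for every monotone
`f : V → V`, it outputs a fixed point of `f` with probability at least `9/10`. -/
def SolvesTarski {V : Type} [Preorder V] (A : RandomizedQueryAlgorithm V) : Prop :=
  ∀ f : V → V, Monotone f → 9 / 10 ≤ A.successProb f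

end RandomizedQueryAlgorithm

/-- The randomized query complexity of `TARSKI(n, k)`: the worst-case (over monotone functions
on the grid) expected number of queries of the best randomized algorithm that succeeds with
probability at least `9/10` on every monotone function. -/
noncomputable def tarskiRandomizedQueryComplexity (n k : ℕ) : ℝ≥0∞ :=
  ⨅ (A : RandomizedQueryAlgorithm (Grid n k)) (_ : A.SolvesTarski),
    ⨆ (f : Grid n k → Grid n k) (_ : Monotone f), A.expectedQueries f

/-! Hard instances: `herringbone a` is monotone with unique fixed point `a`, and an answer moves
only the first coordinate above `a` and the first below it. Answers carry little information, in two
senses. Dimension: for targets in the cube `{0,1}^k`, distinguishing a target from its flip at `l`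
takes a query where `l` moves in one of the two answers. Each query moves at most two coordinates,
so summing over `l` gives order `k` queries (`sum_success_cube_le`). Counting: a query has at most
`(k + 1) ^ 2` answers, so `m` queries find at most `(k + 1) ^ (2 * m)` of the `n ^ k` targets
(`card_solved_le`). Averaging over targets carries both bounds to randomized algorithms. -/

namespace QueryTree

/-! ### Weighted query counts -/

/-- The total weight of the queries that the algorithm makes when the oracle is `f`. -/
def queryWeight {V : Type} (f : V → V) (w : V → ℕ) : QueryTree V → ℕ
  | output _ => 0
  | query v next => queryWeight f w (next (f v)) + w v

theorem sum_queryWeight_le {V ι : Type} [Fintype ι] (f : V → V) (w : ι → V → ℕ) (b : ℕ)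
    (hw : ∀ v, ∑ i, w i v ≤ b) (t : QueryTree V) :
    ∑ i, t.queryWeight f (w i) ≤ b * t.numQueries f := by
  induction t with
  | output x => simp [queryWeight]
  | query v next ih =>
    simp only [queryWeight, numQueries, Finset.sum_add_distrib, mul_add, mul_one]
    exact add_le_add (ih _) (hw v)

open Classical in
/-- The indicator of the event that the algorithm outputs a fixed point of `f`. -/
noncomputable def score {V : Type} (f : V → V) (t : QueryTree V) : ℕ :=
  if f (t.result f) = t.result f then 1 else 0

theorem score_le_one {V : Type} (f : V → V) (t : QueryTree V) : t.score f ≤ 1 := by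
  unfold score
  split_ifs <;> simp

/-- If two oracles have no common fixed point, then an algorithm that succeeds on both makes a query
on which they differ. -/
theorem score_add_score_le {V : Type} {f g : V → V} (hfix : ∀ x, f x = x → g x ≠ x)
    (w w' : V → ℕ) (hw : ∀ v, f v ≠ g v → 1 ≤ w v + w' v) (t : QueryTree V) :
    t.score f + t.score g ≤ 1 + (t.queryWeight f w + t.queryWeight g w') := by
  induction t with
  | output x =>
    by_cases h : f x = x
    · simp [score, result, h, hfix x h]
    · have : score f (output x) = 0 := by simp [score, result, h]
      have := score_le_one g (output x)
      omega
  | query v next ih =>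
    have hf : score f (query v next) = score f (next (f v)) := rfl
    have hg : score g (query v next) = score g (next (g v)) := rfl
    simp only [hf, hg, queryWeight]
    by_cases h : f v = g v
    · have := ih (f v)
      rw [← h]
      omega
    -- The runs part here: the weight of this query pays for the second success.
    · have := hw v h
      have := score_le_one f (next (f v))
      have := score_le_one g (next (g v))
      omega

end QueryTree

/-! ### The hard functions -/

section Herringbone

variable {n k : ℕ}

/-- The function on the grid that moves the first coordinate above `a` down by one and the first
coordinate below `a` up by one. -/
def herringbone (a v : Grid n k) : Grid n k := fun i =>
  if a i < v i ∧ ∀ j < i, v j ≤ a j then ⟨v i - 1, by omega⟩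
  else if h : v i < a i ∧ ∀ j < i, a j ≤ v j then
    ⟨v i + 1, lt_of_le_of_lt (Nat.succ_le_of_lt (Fin.lt_def.1 h.1)) (a i).2⟩
  else v i

theorem val_herringbone (a v : Grid n k) (i : Fin k) :
    (herringbone a v i : ℕ) =
      if a i < v i ∧ ∀ j < i, v j ≤ a j then (v i : ℕ) - 1
      else if v i < a i ∧ ∀ j < i, a j ≤ v j then (v i : ℕ) + 1 else v i := by
  unfold herringbone
  split_ifs <;> rfl

/-- Values on opposite sides of `c` differ by at least 2, so one step each cannot make them cross.
Equal values are handled by the implications between the guards. -/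
theorem step_toward_mono {x y c : ℕ} {D D' U U' : Prop} [Decidable D] [Decidable D'] [Decidable U]
    [Decidable U'] (hxy : x ≤ y) (hD : D' → D) (hU : U → U') :
    (if c < x ∧ D then x - 1 else if x < c ∧ U then x + 1 else x) ≤
      if c < y ∧ D' then y - 1 else if y < c ∧ U' then y + 1 else y := by
  grind

theorem herringbone_monotone (a : Grid n k) : Monotone (herringbone a) := by
  intro u v huv i
  rw [Fin.le_def, val_herringbone, val_herringbone]
  exact step_toward_mono (huv i) (fun h j hj => (huv j).trans (h j hj))
    (fun h j hj => (h j hj).trans (huv j))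

/-- At the first coordinate where `v` and `a` differ, both prefix guards hold, so that coordinate
moves. -/
theorem herringbone_eq_self_iff {a v : Grid n k} : herringbone a v = v ↔ v = a := by
  constructor
  · intro h
    by_contra hne
    obtain ⟨l, hl⟩ : ∃ l, v l ≠ a l := Function.ne_iff.1 hne
    obtain ⟨i, hi, hmin⟩ := WellFounded.has_min (wellFounded_lt (α := Fin k)) {l | v l ≠ a l} ⟨l, hl⟩
    have heq : ∀ j < i, v j = a j := fun j hj => not_not.1 fun hj' => hmin j hj' hj
    have hval := congrArg Fin.val (congrFun h i)
    rw [val_herringbone] at hval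
    have h1 : ∀ j < i, v j ≤ a j := fun j hj => (heq j hj).le
    have h2 : ∀ j < i, a j ≤ v j := fun j hj => (heq j hj).ge
    have h3 : (v i : ℕ) ≠ a i := fun h => hi (Fin.ext h)
    rw [if_congr (and_iff_left h1) rfl rfl, if_congr (and_iff_left h2) rfl rfl] at hval
    simp only [Fin.lt_def] at hval
    split_ifs at hval <;> omega
  · rintro rfl
    ext i
    simp [val_herringbone]

/-- The vertex `v` with the coordinate `p` moved down and the coordinate `q` moved up. -/
def moveCoords (v : Grid n k) (p q : Option (Fin k)) : Grid n k := fun i =>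
  if p = some i then ⟨v i - 1, by omega⟩
  else if h : q = some i ∧ (v i : ℕ) + 1 < n then ⟨v i + 1, h.2⟩ else v i

theorem exists_option_eq_some_iff {α : Type} (P : α → Prop) (hP : ∀ x y, P x → P y → x = y) :
    ∃ o : Option α, ∀ x, o = some x ↔ P x := by
  by_cases h : ∃ x, P x
  · obtain ⟨x, hx⟩ := h
    exact ⟨some x, fun y => ⟨fun e => Option.some.inj e ▸ hx, fun hy => congrArg some (hP x y hx hy)⟩⟩
  · exact ⟨none, fun y => ⟨(fun e => nomatch e), fun hy => (h ⟨y, hy⟩).elim⟩⟩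

theorem exists_herringbone_eq_moveCoords (a v : Grid n k) :
    ∃ p q, herringbone a v = moveCoords v p q := by
  obtain ⟨p, hp⟩ := exists_option_eq_some_iff (fun i => a i < v i ∧ ∀ j < i, v j ≤ a j) (by
    rintro x y ⟨hx, hx'⟩ ⟨hy, hy'⟩
    rcases lt_trichotomy x y with h | h | h
    · exact absurd hx (hy' x h).not_gt
    · exact h
    · exact absurd hy (hx' y h).not_gt)
  obtain ⟨q, hq⟩ := exists_option_eq_some_iff (fun i => v i < a i ∧ ∀ j < i, a j ≤ v j) (by
    rintro x y ⟨hx, hx'⟩ ⟨hy, hy'⟩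
    rcases lt_trichotomy x y with h | h | h
    · exact absurd hx (hy' x h).not_gt
    · exact h
    · exact absurd hy (hx' y h).not_gt)
  refine ⟨p, q, ?_⟩
  ext i
  rw [val_herringbone]
  unfold moveCoords
  simp only [hp, hq]
  by_cases h : v i < a i ∧ ∀ j < i, a j ≤ v j
  · have : (v i : ℕ) + 1 < n := by have := Fin.lt_def.1 h.1; omega
    rw [dif_pos ⟨h, this⟩, if_pos h]
    split_ifs <;> rfl
  · rw [dif_neg (fun h' => h h'.1), if_neg h]
    split_ifs <;> rfl

theorem sum_moved_coords_le (a v : Grid n k) :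
    ∑ l, (if herringbone a v l ≠ v l then 1 else 0) ≤ 2 := by
  obtain ⟨p, q, h⟩ := exists_herringbone_eq_moveCoords a v
  rw [h, ← Finset.card_filter]
  have hsub : (Finset.univ.filter fun l => moveCoords v p q l ≠ v l) ⊆ p.toFinset ∪ q.toFinset := by
    intro l hl
    simp only [Finset.mem_filter, Finset.mem_univ, true_and] at hl
    by_contra hl'
    simp only [Finset.mem_union, Option.mem_toFinset, Option.mem_def, not_or] at hl'
    exact hl (by simp [moveCoords, hl'])
  have hcard (o : Option (Fin k)) : o.toFinset.card ≤ 1 := by cases o <;> simp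
  exact (Finset.card_le_card hsub).trans ((Finset.card_union_le _ _).trans
    (add_le_add (hcard p) (hcard q)))

theorem card_image_herringbone_le (v : Grid n k) :
    (Finset.univ.image fun a : Grid n k => herringbone a v).card ≤ (k + 1) ^ 2 := by
  have hsub : (Finset.univ.image fun a : Grid n k => herringbone a v) ⊆
      Finset.univ.image fun pq : Option (Fin k) × Option (Fin k) => moveCoords v pq.1 pq.2 := by
    intro y hy
    obtain ⟨a, -, rfl⟩ := Finset.mem_image.1 hy
    obtain ⟨p, q, h⟩ := exists_herringbone_eq_moveCoords a v
    exact Finset.mem_image.2 ⟨(p, q), Finset.mem_univ _, h.symm⟩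
  refine (Finset.card_le_card hsub).trans (Finset.card_image_le.trans ?_)
  simp [pow_two]

/-- Changing the coordinate `l` of the fixed point goes unnoticed by a query unless one of the two
answers moves the coordinate `l`. -/
theorem herringbone_eq_of_agree_off {a b v : Grid n k} {l : Fin k} (hab : ∀ j, j ≠ l → a j = b j)
    (ha : herringbone a v l = v l) (hb : herringbone b v l = v l) :
    herringbone a v = herringbone b v := by
  -- A coordinate that is off target but does not move is blocked by an earlier coordinate on the
  -- same side.
  have stuck : ∀ c : Grid n k, herringbone c v l = v l →
      (c l < v l → ∃ j < l, c j < v j) ∧ (v l < c l → ∃ j < l, v j < c j) := by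
    intro c hc
    have hval := congrArg Fin.val hc
    rw [val_herringbone] at hval
    constructor
    · intro hlt
      by_contra! hall
      rw [if_pos ⟨hlt, hall⟩] at hval
      have := Fin.lt_def.1 hlt
      omega
    · intro hlt
      by_contra! hall
      rw [if_neg (fun h => h.1.not_gt hlt), if_pos ⟨hlt, hall⟩] at hval
      omega
  -- The blocking coordinate is not `l`, so it is common to `a` and `b`; hence `l` never decides a
  -- later guard.
  have transfer : ∀ a b : Grid n k, (∀ j, j ≠ l → a j = b j) → herringbone a v l = v l →
      herringbone b v l = v l → ∀ i, i ≠ l →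
      ((∀ j < i, v j ≤ a j) → ∀ j < i, v j ≤ b j) ∧ ((∀ j < i, a j ≤ v j) → ∀ j < i, b j ≤ v j) := by
    intro a b hab ha hb i hi
    constructor <;> intro h j hj
    · by_cases hjl : j = l
      · subst hjl
        by_contra! hlt
        obtain ⟨m, hm, hm'⟩ := (stuck b hb).1 hlt
        exact ((hab m hm.ne ▸ h m (hm.trans hj)).not_gt hm')
      · exact hab j hjl ▸ h j hj
    · by_cases hjl : j = l
      · subst hjl
        by_contra! hlt
        obtain ⟨m, hm, hm'⟩ := (stuck b hb).2 hlt
        exact ((hab m hm.ne ▸ h m (hm.trans hj)).not_gt hm')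
      · exact hab j hjl ▸ h j hj
  funext i
  by_cases hi : i = l
  · rw [hi, ha, hb]
  · have h1 := transfer a b hab ha hb i hi
    have h2 := transfer b a (fun j hj => (hab j hj).symm) hb ha i hi
    apply Fin.ext
    have hdown : (∀ j < i, v j ≤ a j) ↔ ∀ j < i, v j ≤ b j := ⟨h1.1, h2.1⟩
    have hup : (∀ j < i, a j ≤ v j) ↔ ∀ j < i, b j ≤ v j := ⟨h1.2, h2.2⟩
    simp only [val_herringbone, hab i hi, hdown, hup]

/-! ### Counting the targets found by few queries -/

open Classical in
/-- With at most `m` queries, a deterministic algorithm finds at most `(k + 1) ^ (2 * m)` of the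
fixed points of the functions `herringbone a`. -/
theorem card_solved_le (t : QueryTree (Grid n k)) (m : ℕ) :
    (Finset.univ.filter fun a : Grid n k =>
      herringbone a (t.result (herringbone a)) = t.result (herringbone a) ∧
        t.numQueries (herringbone a) ≤ m).card ≤ ((k + 1) ^ 2) ^ m := by
  induction t generalizing m with
  | output x =>
    refine le_trans (Finset.card_le_one.2 ?_) (Nat.one_le_pow _ _ (by positivity))
    intro a ha b hb
    simp only [QueryTree.result, herringbone_eq_self_iff, Finset.mem_filter] at ha hb
    exact ha.2.1.symm.trans hb.2.1
  | query v next ih =>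
    cases m with
    | zero => simp [QueryTree.numQueries]
    | succ m =>
      refine le_trans (Finset.card_le_card (t := (Finset.univ.image fun a : Grid n k =>
        herringbone a v).biUnion fun y => Finset.univ.filter fun a : Grid n k =>
          herringbone a ((next y).result (herringbone a)) = (next y).result (herringbone a) ∧
          (next y).numQueries (herringbone a) ≤ m) ?_) ?_
      · intro a ha
        simp only [QueryTree.result, QueryTree.numQueries, Finset.mem_filter, Finset.mem_univ,
          true_and, add_le_add_iff_right] at ha
        refine Finset.mem_biUnion.2 ⟨herringbone a v, Finset.mem_image_of_mem _ (Finset.mem_univ _), ?_⟩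
        simpa using ha
      · refine (Finset.card_biUnion_le_card_mul _ _ _ fun y _ => ih y m).trans ?_
        rw [pow_succ, mul_comm]
        exact Nat.mul_le_mul_left _ (card_image_herringbone_le v)

/-! ### The cube of targets -/

/-- The point of the grid with coordinates `0` and `1` given by the bits of `b`. -/
def cubePoint (hn : 2 ≤ n) (b : Fin k → Bool) : Grid n k := fun i =>
  if b i then ⟨1, hn⟩ else ⟨0, by omega⟩

/-- The bit string `b` with the bit `l` flipped. -/
def flipBit (l : Fin k) (b : Fin k → Bool) : Fin k → Bool := Function.update b l (!b l)

theorem flipBit_involutive (l : Fin k) : Function.Involutive (flipBit l) := by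
  intro b
  simp [flipBit]

/-- Successes on the cube of hard functions have to be paid for by queries. -/
theorem sum_success_cube_le (hn : 2 ≤ n) (t : QueryTree (Grid n k)) :
    2 * k * ∑ b : Fin k → Bool, t.score (herringbone (cubePoint hn b))
      ≤ k * 2 ^ k + 4 * ∑ b : Fin k → Bool, t.numQueries (herringbone (cubePoint hn b)) := by
  set F : (Fin k → Bool) → Grid n k → Grid n k := fun b => herringbone (cubePoint hn b) with hF
  set s : (Fin k → Bool) → ℕ := fun b => t.score (F b)
  set w : (Fin k → Bool) → Fin k → Grid n k → ℕ := fun b l v => if F b v l ≠ v l then 1 else 0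
    with hw
  set h : (Fin k → Bool) → Fin k → ℕ := fun b l => t.queryWeight (F b) (w b l)
  have pair : ∀ l b, s b + s (flipBit l b) ≤ 1 + (h b l + h (flipBit l b) l) := by
    intro l b
    refine QueryTree.score_add_score_le ?_ (w b l) (w (flipBit l b) l) ?_ t
    · intro x hx hx'
      simp only [hF, herringbone_eq_self_iff] at hx hx'
      have := congrFun (hx.symm.trans hx') l
      cases hb : b l <;> simp [cubePoint, flipBit, hb] at this
    · intro v hv
      by_contra hlt
      have h0 : w b l v = 0 ∧ w (flipBit l b) l v = 0 := by omega
      simp only [hw, ne_eq, ite_not, ite_eq_left_iff, one_ne_zero, imp_false, not_not] at h0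
      refine hv (herringbone_eq_of_agree_off (l := l) (fun j hj => ?_) h0.1 h0.2)
      simp [cubePoint, flipBit, hj]
  have flip_sum : ∀ (l : Fin k) (g : (Fin k → Bool) → ℕ), ∑ b, g (flipBit l b) = ∑ b, g b :=
    fun l g => Equiv.sum_comp (flipBit_involutive l).toPerm g
  have coord : ∀ l, 2 * ∑ b, s b ≤ 2 ^ k + 2 * ∑ b, h b l := by
    intro l
    have := Finset.sum_le_sum fun b (_ : b ∈ Finset.univ) => pair l b
    simp only [Finset.sum_add_distrib, flip_sum l s, flip_sum l (fun b => h b l)] at this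
    simp at this
    omega
  -- Each query is charged to the coordinates its answer moves, at most two.
  have hits : ∀ b, ∑ l, h b l ≤ 2 * t.numQueries (F b) := fun b =>
    QueryTree.sum_queryWeight_le (F b) (w b) 2 (fun v => sum_moved_coords_le _ v) t
  have total := Finset.sum_le_sum fun l (_ : l ∈ Finset.univ) => coord l
  rw [Finset.sum_add_distrib, ← Finset.mul_sum Finset.univ (fun l => ∑ b, h b l), Finset.sum_comm] at total
  have total' := Finset.sum_le_sum fun b (_ : b ∈ Finset.univ) => hits b
  rw [← Finset.mul_sum] at total'
  simp only [Finset.sum_const, Finset.card_univ, Fintype.card_fin, smul_eq_mul] at total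
  change 2 * k * ∑ b, s b ≤ k * 2 ^ k + 4 * ∑ b, t.numQueries (F b)
  have hk : 2 * k * ∑ b, s b = k * (2 * ∑ b, s b) := by ring
  omega

end Herringbone

/-! ### Averaging over the randomness -/

section Randomized

open RandomizedQueryAlgorithm

theorem successProb_eq_tsum {V : Type} (A : RandomizedQueryAlgorithm V) (f : V → V) :
    A.successProb f = ∑' t, A t * (t.score f : ℝ≥0∞) := by
  unfold RandomizedQueryAlgorithm.successProb
  rw [PMF.toOuterMeasure_apply]
  refine tsum_congr fun t => ?_
  by_cases h : f (t.result f) = t.result f <;> simp [Set.indicator, QueryTree.score, h]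

variable {n k : ℕ} {A : RandomizedQueryAlgorithm (Grid n k)} {Q : ℝ≥0∞}

theorem dimension_le_expectedQueries (hn : 2 ≤ n) (hA : A.SolvesTarski)
    (hQ : ∀ f, Monotone f → A.expectedQueries f ≤ Q) : (k : ℝ≥0∞) ≤ 5 * Q := by
  have avg : ∑' t, A t * ((2 * k * ∑ b : Fin k → Bool, t.score (herringbone (cubePoint hn b)) : ℕ) : ℝ≥0∞) ≤
      ∑' t, A t * ((k * 2 ^ k + 4 * ∑ b : Fin k → Bool,
        t.numQueries (herringbone (cubePoint hn b)) : ℕ) : ℝ≥0∞) :=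
    ENNReal.tsum_le_tsum fun t => by
      gcongr
      exact sum_success_cube_le hn t
  have lhs : ∑' t, A t * ((2 * k * ∑ b : Fin k → Bool, t.score (herringbone (cubePoint hn b)) : ℕ) : ℝ≥0∞) =
      2 * k * ∑ b : Fin k → Bool, A.successProb (herringbone (cubePoint hn b)) := by
    simp only [successProb_eq_tsum]
    rw [← Summable.tsum_finsetSum fun _ _ => ENNReal.summable, ← ENNReal.tsum_mul_left]
    refine tsum_congr fun t => ?_
    rw [← Finset.mul_sum]
    push_cast
    ring
  have rhs : ∑' t, A t * ((k * 2 ^ k + 4 * ∑ b : Fin k → Bool,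
        t.numQueries (herringbone (cubePoint hn b)) : ℕ) : ℝ≥0∞) =
      k * 2 ^ k + 4 * ∑ b : Fin k → Bool, A.expectedQueries (herringbone (cubePoint hn b)) := by
    unfold RandomizedQueryAlgorithm.expectedQueries
    rw [← Summable.tsum_finsetSum fun _ _ => ENNReal.summable, ← ENNReal.tsum_mul_left]
    have hk : (k * 2 ^ k : ℝ≥0∞) = ∑' t, A t * (k * 2 ^ k) := by
      rw [ENNReal.tsum_mul_right, A.tsum_coe, one_mul]
    rw [hk, ← ENNReal.tsum_add]
    refine tsum_congr fun t => ?_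
    rw [← Finset.mul_sum]
    push_cast
    ring
  rw [lhs, rhs] at avg
  have low : (2 ^ k * (9 / 10) : ℝ≥0∞) ≤
      ∑ b : Fin k → Bool, A.successProb (herringbone (cubePoint hn b)) := by
    refine le_trans (by simp) (Finset.sum_le_sum fun b _ => hA _ (herringbone_monotone _))
  have high : ∑ b : Fin k → Bool, A.expectedQueries (herringbone (cubePoint hn b)) ≤ 2 ^ k * Q := by
    refine (Finset.sum_le_sum fun b _ => hQ _ (herringbone_monotone _)).trans (by simp)
  -- After division by `2 ^ k` this reads `1.8 k ≤ k + 4 Q`.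
  have key : (2 * k * (2 ^ k * (9 / 10)) : ℝ≥0∞) ≤ k * 2 ^ k + 4 * (2 ^ k * Q) :=
    (by gcongr : _ ≤ _).trans (avg.trans (by gcongr))
  rcases eq_or_ne Q ⊤ with rfl | hQt
  · simp
  lift Q to NNReal using hQt
  have h910 : (9 / 10 : ℝ≥0∞) = ((9 / 10 : NNReal) : ℝ≥0∞) := by
    rw [ENNReal.coe_div (by norm_num)]; rfl
  rw [h910] at key
  norm_cast at key ⊢
  rw [← NNReal.coe_le_coe] at key ⊢
  push_cast at key ⊢
  have h2 : (0 : ℝ) < 2 ^ k := by positivity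
  have key' : (2 ^ k : ℝ) * k ≤ 2 ^ k * (5 * Q) := by linarith
  exact le_of_mul_le_mul_left key' h2

open Classical in
theorem card_grid_le_of_expectedQueries_le (hA : A.SolvesTarski) {X : ℝ} (hX : 0 < X)
    (hQ : ∀ f, Monotone f → A.expectedQueries f ≤ ENNReal.ofReal X) :
    (7 / 10 : ℝ) * n ^ k ≤ ((k + 1) ^ 2) ^ ⌊5 * X⌋₊ := by
  set m := ⌊5 * X⌋₊
  set c : ℝ≥0∞ := ENNReal.ofReal (5 * X)⁻¹ with hc
  let g : Grid n k → QueryTree (Grid n k) → ℕ := fun a t =>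
    if herringbone a (t.result (herringbone a)) = t.result (herringbone a) ∧
        t.numQueries (herringbone a) ≤ m then 1 else 0
  -- More than `5 * X` queries occur with probability at most 1/5, leaving 7/10 for success within
  -- `m` queries.
  have markov : ∀ a : Grid n k, (9 / 10 : ℝ≥0∞) ≤ ∑' t, A t * (g a t : ℝ≥0∞) + 1 / 5 := by
    intro a
    calc (9 / 10 : ℝ≥0∞) ≤ A.successProb (herringbone a) := hA _ (herringbone_monotone a)
      _ ≤ ∑' t, (A t * (g a t : ℝ≥0∞) + A t * (t.numQueries (herringbone a)) * c) := by
        rw [successProb_eq_tsum]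
        refine ENNReal.tsum_le_tsum fun t => ?_
        rw [mul_assoc, ← mul_add]
        gcongr
        by_cases hm : t.numQueries (herringbone a) ≤ m
        · simp [g, hm, QueryTree.score]
        · have h5 : 5 * X < t.numQueries (herringbone a) :=
            (Nat.floor_lt (by positivity)).1 (not_le.1 hm)
          have : (1 : ℝ≥0∞) ≤ t.numQueries (herringbone a) * c := by
            rw [hc, ← ENNReal.ofReal_natCast, ← ENNReal.ofReal_mul (by positivity),
              ENNReal.one_le_ofReal, ← div_eq_mul_inv, one_le_div (by positivity)]
            exact h5.le
          refine le_trans ?_ (this.trans le_add_self)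
          exact_mod_cast QueryTree.score_le_one _ t
      _ = ∑' t, A t * (g a t : ℝ≥0∞) + A.expectedQueries (herringbone a) * c := by
        rw [ENNReal.tsum_add, ENNReal.tsum_mul_right]
        rfl
      _ ≤ ∑' t, A t * (g a t : ℝ≥0∞) + ENNReal.ofReal X * c := by
        gcongr
        exact hQ _ (herringbone_monotone a)
      _ = _ := by
        congr 1
        rw [hc, ← ENNReal.ofReal_mul hX.le, mul_inv, mul_left_comm, mul_inv_cancel₀ hX.ne', mul_one,
          ENNReal.ofReal_inv_of_pos (by norm_num)]
        simp
  have count : ∑ a : Grid n k, ∑' t, A t * (g a t : ℝ≥0∞) ≤ (((k + 1) ^ 2) ^ m : ℕ) := by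
    rw [← Summable.tsum_finsetSum fun _ _ => ENNReal.summable]
    calc ∑' t, ∑ a, A t * (g a t : ℝ≥0∞) ≤ ∑' t, A t * (((k + 1) ^ 2) ^ m : ℕ) := by
          refine ENNReal.tsum_le_tsum fun t => ?_
          rw [← Finset.mul_sum, ← Nat.cast_sum]
          gcongr
          simp only [g]
          rw [← Finset.card_filter]
          exact card_solved_le t m
      _ = _ := by rw [ENNReal.tsum_mul_right, A.tsum_coe, one_mul]
  have total := Finset.sum_le_sum fun a (_ : a ∈ Finset.univ) => markov a
  rw [Finset.sum_add_distrib] at total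
  replace total := total.trans (add_le_add_left count _)
  simp only [Finset.sum_const, Finset.card_univ, Fintype.card_pi, Fintype.card_fin,
    Finset.prod_const, nsmul_eq_mul] at total
  have h910 : (9 / 10 : ℝ≥0∞) = ((9 / 10 : NNReal) : ℝ≥0∞) := by
    rw [ENNReal.coe_div (by norm_num)]; rfl
  have h15 : (1 / 5 : ℝ≥0∞) = ((1 / 5 : NNReal) : ℝ≥0∞) := by
    rw [ENNReal.coe_div (by norm_num)]; rfl
  rw [h910, h15] at total
  norm_cast at total
  rw [← NNReal.coe_le_coe] at total
  push_cast at total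
  linarith

theorem mul_log_le_of_expectedQueries_le (hn : 2 ≤ n) (hk : 2 ≤ k) (hA : A.SolvesTarski) {X : ℝ}
    (hX : 0 < X) (hQ : ∀ f, Monotone f → A.expectedQueries f ≤ ENNReal.ofReal X) :
    k * Real.log n / Real.log k ≤ 40 * X := by
  have hn' : (2 : ℝ) ≤ n := by exact_mod_cast hn
  have hk' : (2 : ℝ) ≤ k := by exact_mod_cast hk
  have hlogk : 0 < Real.log k := Real.log_pos (by linarith)
  have hlogn : 0.69 ≤ Real.log n :=
    le_trans (by linarith [Real.log_two_gt_d9]) (Real.log_le_log (by norm_num) hn')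
  have h := Real.log_le_log (by positivity) (card_grid_le_of_expectedQueries_le hA hX hQ)
  rw [Real.log_mul (by norm_num) (by positivity), Real.log_pow, Real.log_pow, Real.log_pow] at h
  have h7 : 1 - (7 / 10 : ℝ)⁻¹ ≤ Real.log (7 / 10) :=
    Real.one_sub_inv_le_log_of_pos (by norm_num)
  have hk1 : Real.log (k + 1) ≤ 2 * Real.log k := by
    have : Real.log (k + 1) ≤ Real.log ((k : ℝ) ^ 2) :=
      Real.log_le_log (by positivity) (by nlinarith)
    rwa [Real.log_pow] at this
  have hm : (⌊5 * X⌋₊ : ℝ) ≤ 5 * X := Nat.floor_le (by positivity)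
  -- This makes the loss `-log (7/10) ≤ 3/7` at most half of `k * log n`, turning the factor 20 into
  -- 40.
  have hkn : 2 * 0.69 ≤ k * Real.log n := mul_le_mul hk' hlogn (by norm_num) (by positivity)
  have hlogk1 : 0 ≤ Real.log ((k : ℝ) + 1) := Real.log_nonneg (by linarith)
  have hmul : (⌊5 * X⌋₊ : ℝ) * (2 * Real.log (k + 1)) ≤ 5 * X * (2 * (2 * Real.log k)) := by
    gcongr
  rw [div_le_iff₀ hlogk]
  push_cast at h
  norm_num at h7 hkn
  linarith

end Randomized

theorem theorem1 :
    ∃ c : ℝ, 0 < c ∧ ∀ k n : ℕ, 2 ≤ k → 2 ≤ n →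
      ENNReal.ofReal (c * ((k : ℝ) + (k : ℝ) * Real.log n / Real.log k)) ≤
        tarskiRandomizedQueryComplexity n k := by
  -- The two bounds add up to `45 * Q`, so 1/80 leaves room.
  refine ⟨1 / 80, by norm_num, fun k n hk hn => le_iInf₂ fun A hA => ?_⟩
  set Q := ⨆ (f : Grid n k → Grid n k) (_ : Monotone f), A.expectedQueries f with hQdef
  have hQ : ∀ f, Monotone f → A.expectedQueries f ≤ Q := fun f hf => le_iSup₂_of_le f hf le_rfl
  rcases eq_or_ne Q ⊤ with h | hQt
  · rw [h]
    exact le_top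
  have hdim : (k : ℝ) ≤ 5 * Q.toReal := by
    have := ENNReal.toReal_mono (ENNReal.mul_ne_top (by simp) hQt)
      (dimension_le_expectedQueries hn hA hQ)
    simpa using this
  have hk' : (2 : ℝ) ≤ k := by exact_mod_cast hk
  -- The dimension bound also supplies the positivity of `Q`.
  have hlog := mul_log_le_of_expectedQueries_le hn hk hA (X := Q.toReal) (by linarith)
    (by rwa [ENNReal.ofReal_toReal hQt])
  exact ENNReal.ofReal_le_of_le_toReal (by linarith)
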